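/- A Seidel matrix of order $n$ is a symmetric $n\times n$ integer matrix with zero diagonal all of whose off-diagonal entries are $\pm 1$. For a Seidel matrix $S$ let $\chi_S(x)=\det(xI-S)\in\mathbb Z[x]$ be its characteristic polynomial. For positive integers $n$ and $e$ let $\mathcal P_{n,e}$ be the set of congruence classes modulo the ideal $2^e\mathbb Z[x]$ of the polynomials $\chi_S(x)$, where $S$ ranges over all Seidel matrices of order $n$. If $n$ is odd and $e$ is a positive integer, then $$|\mathcal P_{n,e}|\le 2^{\binom{e-2}{2}+1},$$ where $\binom{m}{2}$ is read as $0$ for every integer $m<2$ (so for $e=1$ the bound is $2$). -/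

import Mathlib

/-- A Seidel matrix of order `n`: a symmetric integer matrix with zero diagonal all of whose
off-diagonal entries are `1` or `-1`. -/
structure IsSeidelMatrix {n : ℕ} (S : Matrix (Fin n) (Fin n) ℤ) : Prop where
  isSymm : S.IsSymm
  diag_eq_zero : ∀ i, S i i = 0
  off_diag : ∀ i j, i ≠ j → S i j = 1 ∨ S i j = -1

/-- The set of all Seidel matrices of order `n`. -/
def seidelMatrices (n : ℕ) : Set (Matrix (Fin n) (Fin n) ℤ) :=
  {S | IsSeidelMatrix S}

/-- The ideal `2 ^ e ℤ[x]` of `ℤ[x]`. -/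
noncomputable def twoPowIdeal (e : ℕ) : Ideal (Polynomial ℤ) :=
  Ideal.span {Polynomial.C ((2 : ℤ) ^ e)}

/-- The set of congruence classes modulo `2 ^ e ℤ[x]` of the characteristic polynomials
`det (x I - S)` of the Seidel matrices `S` of order `n`. -/
def seidelCharpolyClasses (n e : ℕ) : Set (Polynomial ℤ ⧸ twoPowIdeal e) :=
  (fun S : Matrix (Fin n) (Fin n) ℤ => Ideal.Quotient.mk (twoPowIdeal e) S.charpoly) ''
    seidelMatrices n

/-! Write `S + 1 = J - 2A`, with `J` all ones and `A` the adjacency matrix of a graph. Put `f = det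
(1 + xA)`, with coefficients `c k`, and let `g` be the determinant of `1 + xA` bordered by ones with
corner `0`. Since `J` has rank one, `det (1 - x(S + 1)) = f(2x) + x g(2x)`, so its coefficient of
degree `k ≥ 1` is `2 ^ (k - 1) * b k` for an integer `b k`. Modulo `2 ^ e` only `b k` modulo `2 ^ (e
- k + 1)` matters, and degrees below `3` are constant. It remains to see that the parities of the `b
k` with `k ≥ 4` are redundant.

This comes from `f(x)² ≡ (n + 1) f(x²) + g(x²)` modulo 4 (`det_sq_eq_det_borderedMatrix`). Its odd
degrees force `c` to be even at odd indices. Its even degrees give, for odd `n`, `b (k + 1) ≡ c k`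
modulo 2, and for `k ≥ 2` they recover `c (2k)` modulo 2 from `b (k + 1)` modulo 4 and earlier
parities. So the parity of `b (2k + 1)` is forced by earlier `b`'s, and only that of `b 3` is free.
-/

open Matrix Polynomial

/-! ### Bordered determinants and squares of symmetric determinants modulo 4 -/

section Bordered

variable {R : Type*} {n : ℕ}

/-- The the bordered matrix `[[s, v], [u, P]]`. -/
def borderedMatrix (P : Matrix (Fin n) (Fin n) R) (u v : Fin n → R) (s : R) :
    Matrix (Fin (n + 1)) (Fin (n + 1)) R :=
  Matrix.of (Fin.cons (Fin.cons s v) fun i => Fin.cons (u i) (P i))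

@[simp] theorem borderedMatrix_zero_zero (P : Matrix (Fin n) (Fin n) R) (u v : Fin n → R) (s : R) :
    borderedMatrix P u v s 0 0 = s := rfl

@[simp] theorem borderedMatrix_zero_succ (P : Matrix (Fin n) (Fin n) R) (u v : Fin n → R) (s : R)
    (j : Fin n) : borderedMatrix P u v s 0 j.succ = v j := rfl

@[simp] theorem borderedMatrix_succ_zero (P : Matrix (Fin n) (Fin n) R) (u v : Fin n → R) (s : R)
    (i : Fin n) : borderedMatrix P u v s i.succ 0 = u i := rfl

@[simp] theorem borderedMatrix_succ_succ (P : Matrix (Fin n) (Fin n) R) (u v : Fin n → R) (s : R)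
    (i j : Fin n) : borderedMatrix P u v s i.succ j.succ = P i j := rfl

variable [CommRing R]

theorem det_borderedMatrix_smul (P : Matrix (Fin n) (Fin n) R) (u v : Fin n → R) (s t : R) :
    (borderedMatrix P (t • u) v s).det = s * P.det + t * (borderedMatrix P u v 0).det := by
  have h (u : Fin n → R) (s : R) : (borderedMatrix P u v s).det = s * P.det +
      ∑ i : Fin n, (-1) ^ (i.succ : ℕ) * u i *
        ((borderedMatrix P 0 v 0).submatrix i.succ.succAbove Fin.succ).det := by
    rw [det_succ_column_zero, Fin.sum_univ_succ]
    congr 1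
    · simp only [Fin.val_zero, pow_zero, one_mul, borderedMatrix_zero_zero]
      rfl
    · refine Finset.sum_congr rfl fun i _ => ?_
      rw [borderedMatrix_succ_zero]
      congr 2
      ext k l
      simp only [submatrix_apply]
      generalize i.succ.succAbove k = m
      refine Fin.cases ?_ (fun m => ?_) m <;> rfl
  rw [h, h, zero_mul, zero_add, Finset.mul_sum]
  congr 1
  refine Finset.sum_congr rfl fun i _ => ?_
  rw [Pi.smul_apply, smul_eq_mul]
  ring

theorem det_borderedMatrix (P : Matrix (Fin n) (Fin n) R) (u v : Fin n → R) (s : R) :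
    (borderedMatrix P u v s).det = s * P.det + (borderedMatrix P u v 0).det := by
  simpa using det_borderedMatrix_smul P u v s 1

theorem map_borderedMatrix {S : Type*} [CommRing S] (f : R →+* S) (P : Matrix (Fin n) (Fin n) R)
    (u v : Fin n → R) (s : R) :
    f.mapMatrix (borderedMatrix P u v s) =
      borderedMatrix (f.mapMatrix P) (f ∘ u) (f ∘ v) (f s) := by
  ext i j
  refine Fin.cases ?_ (fun i => ?_) i <;> refine Fin.cases ?_ (fun j => ?_) j <;> simp

/-- Pivoting at a diagonal entry with inverse `u`. -/
theorem det_eq_mul_det_schur (Z : Matrix (Fin (n + 1)) (Fin (n + 1)) R) (p : Fin (n + 1)) (u : R)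
    (hu : u * Z p p = 1) :
    Z.det = Z p p * (Matrix.of fun i j : Fin n => Z (p.succAbove i) (p.succAbove j) -
      u * Z (p.succAbove i) p * Z p (p.succAbove j)).det := by
  let c : Fin (n + 1) → R := fun i => if i = p then 0 else u * Z i p
  let B : Matrix (Fin (n + 1)) (Fin (n + 1)) R := Matrix.of fun i j => Z i j - c i * Z p j
  have hB : Z.det = B.det := by
    refine det_eq_of_forall_row_eq_smul_add_const c p (by simp [c]) fun i j => ?_
    simp [B, c]
  have hp : B p p = Z p p := by simp [B, c]
  have hz (i : Fin (n + 1)) (hi : i ≠ p) : B i p = 0 := by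
    simp only [B, c, of_apply, if_neg hi]
    linear_combination (-Z i p) * hu
  rw [hB, det_succ_column B p, Finset.sum_eq_single p]
  · rw [← two_mul, pow_mul, neg_one_sq, one_pow, one_mul, hp]
    congr 2
    ext i j
    simp [B, c, Fin.succAbove_ne]
  · intro i _ hi
    rw [hz i hi]
    ring
  · simp

/-- The Schur complement at the border corner. -/
theorem det_borderedMatrix_one (P : Matrix (Fin n) (Fin n) R) (u v : Fin n → R) :
    (borderedMatrix P u v 1).det = (P - vecMulVec u v).det := by
  rw [det_eq_mul_det_schur _ 0 1 (by simp)]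
  simp only [borderedMatrix_zero_zero, one_mul]
  congr 1

theorem two_mul_sum_sum_of_symm (h4 : (4 : R) = 0) (f : Fin n → Fin n → R)
    (hf : ∀ i j, f i j = f j i) : 2 * ∑ i, ∑ j, f i j = 2 * ∑ i, f i i := by
  induction n with
  | zero => simp
  | succ n ih =>
    have := ih (fun i j => f i.succ j.succ) fun i j => hf _ _
    simp only [Fin.sum_univ_succ, Finset.sum_add_distrib]
    simp only [hf (Fin.succ _) 0]
    linear_combination this + (∑ j : Fin n, f 0 j.succ) * h4

/-- The expansion stops at first order because `4 = 0`. In the trace term, symmetry pairs the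
off-diagonal products, so with the factor 2 they vanish too. -/
theorem det_add_two_smul (h4 : (4 : R) = 0) (Z T : Matrix (Fin n) (Fin n) R) (hZ : Z.IsSymm)
    (hT : T.IsSymm) (hu : IsUnit Z.det) :
    (Z + (2 : R) • T).det = Z.det + 2 * ∑ i, Z.adjugate i i * T i i := by
  have h1 : Z + (2 : R) • T = Z * (1 + (2 : R) • (Z⁻¹ * T)) := by
    rw [mul_add, mul_one, mul_smul_comm, mul_nonsing_inv_cancel_left _ _ hu]
  have h2 : Z.det * (Z⁻¹ * T).trace = (Z.adjugate * T).trace := by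
    rw [← smul_eq_mul, ← trace_smul, ← smul_mul_assoc, Matrix.inv_def, smul_smul,
      Ring.mul_inverse_cancel _ hu, one_smul]
  have h3 : 2 * (Z.adjugate * T).trace = 2 * ∑ i, Z.adjugate i i * T i i := by
    rw [← two_mul_sum_sum_of_symm h4 (fun i j => Z.adjugate i j * T i j)]
    · simp only [trace, diag, mul_apply]
      simp only [fun i j => hT.apply i j]
    · intro i j
      have : Z.adjugate.IsSymm := by rw [Matrix.IsSymm, adjugate_transpose, hZ.eq]
      rw [this.apply, hT.apply]
  rw [h1, det_mul, det_one_add_smul]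
  linear_combination 2 * h2 + h3 +
    Z.det * (eval 2 (1 + (X : R[X]) • (Z⁻¹ * T).map C).det.divX.divX) * h4

/-- Squaring entries commutes with the determinant modulo two. -/
theorem two_mul_det_sq (h4 : (4 : R) = 0) (P : Matrix (Fin n) (Fin n) R) :
    2 * (P.map fun x => x ^ 2).det = 2 * P.det ^ 2 := by
  let q := Ideal.Quotient.mk (Ideal.span {(2 : R)})
  have h : q (P.map fun x => x ^ 2).det = q (P.det ^ 2) := by
    have h2 : (2 : R ⧸ Ideal.span {(2 : R)}) = 0 := by
      rw [← map_ofNat q 2]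
      exact Ideal.Quotient.eq_zero_iff_mem.mpr (Ideal.mem_span_singleton_self _)
    rcases subsingleton_or_nontrivial (R ⧸ Ideal.span {(2 : R)}) with hs | hs
    · exact Subsingleton.elim _ _
    · have := CharTwo.of_one_ne_zero_of_two_eq_zero one_ne_zero h2
      have := RingHom.map_det (frobenius (R ⧸ Ideal.span {(2 : R)}) 2) (q.mapMatrix P)
      rw [frobenius_def, ← RingHom.map_det] at this
      rw [map_pow, this, RingHom.map_det]
      congr 1
  rw [Ideal.Quotient.eq, Ideal.mem_span_singleton] at h
  obtain ⟨r, hr⟩ := h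
  linear_combination 2 * hr + r * h4

/-- Modulo four, the square of the determinant of a symmetric matrix is the determinant of the
matrix of squared entries, bordered by the original diagonal. -/
theorem det_sq_eq_det_borderedMatrix (h4 : (4 : R) = 0) (J : Ideal R)
    (hJ : ∀ x ∈ J, IsUnit (1 + x)) (P : Matrix (Fin n) (Fin n) R) (hP : P.IsSymm)
    (hPJ : ∀ i j, P i j - (1 : Matrix (Fin n) (Fin n) R) i j ∈ J) :
    IsUnit P.det ∧ P.det ^ 2 =
      (borderedMatrix (P.map fun x => x ^ 2) P.diag P.diag (n + 1)).det := by
  induction n using Nat.strong_induction_on with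
  | _ n ih =>
  cases n with
  | zero => 
    refine ⟨by simp, ?_⟩
    rw [det_borderedMatrix, det_succ_row_zero (borderedMatrix _ _ _ _)]
    simp
  | succ n =>
    have ha : IsUnit (P 0 0) := by
      have := hJ _ (hPJ 0 0)
      simpa using this
    obtain ⟨u, hu⟩ := ha.exists_left_inv
    let Q : Matrix (Fin n) (Fin n) R := Matrix.of fun i j =>
      P i.succ j.succ - u * P i.succ 0 * P 0 j.succ
    have hdet : P.det = P 0 0 * Q.det := det_eq_mul_det_schur P 0 u hu
    have hs (i j) : P i j = P j i := hP.apply j i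
    have hQ : Q.IsSymm := by
      refine Matrix.IsSymm.ext fun i j => ?_
      simp only [Q, of_apply]
      rw [hs j.succ i.succ, hs j.succ 0, hs 0 i.succ]
      ring
    have hQJ (i j) : Q i j - (1 : Matrix (Fin n) (Fin n) R) i j ∈ J := by
      have h1 := hPJ i.succ j.succ
      have h2 := hPJ 0 j.succ
      rw [one_apply_ne (Fin.succ_ne_zero j).symm, sub_zero] at h2
      have h3 : (1 : Matrix (Fin (n + 1)) (Fin (n + 1)) R) i.succ j.succ =
        (1 : Matrix (Fin n) (Fin n) R) i j := by simp [one_apply]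
      rw [h3] at h1
      convert J.sub_mem h1 (J.mul_mem_left (u * P i.succ 0) h2) using 1
      simp only [Q, of_apply]
      ring
    obtain ⟨hQu, hQ2⟩ := ih n (Nat.lt_succ_self n) Q hQ hQJ
    refine ⟨hdet ▸ ha.mul hQu, ?_⟩
    set Z := borderedMatrix (Q.map fun x => x ^ 2) Q.diag Q.diag ((n : R) + 1) with hZ
    -- This minor is the bordered matrix of `Q'`, but with corner one too large. By induction it
    -- equals `det Q' ^ 2` plus the determinant of the squared entries, and these agree after
    -- doubling.
    have hadj (i : Fin n) : 2 * Z.adjugate i.succ i.succ = 0 := by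
      cases n with
      | zero => exact i.elim0
      | succ n =>
        let Q' := Q.submatrix i.succAbove i.succAbove
        have hQ' := (ih n (by omega) Q' (hQ.submatrix _) fun k l => by
          simpa [Q', one_apply] using hQJ (i.succAbove k) (i.succAbove l)).2
        have h1 : Z.adjugate i.succ i.succ =
            (borderedMatrix (Q'.map fun x => x ^ 2) Q'.diag Q'.diag (((n + 1 : ℕ) : R) + 1)).det := by
          rw [adjugate_fin_succ_eq_det_submatrix, ← two_mul, pow_mul, neg_one_sq, one_pow, one_mul]
          congr 1
          ext k l
          refine Fin.cases ?_ (fun k => ?_) k <;> refine Fin.cases ?_ (fun l => ?_) l <;>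
            simp [Z, Q']
        rw [h1, det_borderedMatrix]
        rw [det_borderedMatrix] at hQ'
        have h2 := two_mul_det_sq h4 Q'
        push_cast
        linear_combination h2 - 2 * hQ' + Q'.det ^ 2 * h4
    let r : Fin n → R := fun i => P 0 i.succ
    let T : Matrix (Fin (n + 1)) (Fin (n + 1)) R :=
      borderedMatrix (Matrix.of fun i j => u * r i * r j * Q i j) 0 0 0
    have hZs : Z.IsSymm := by
      refine Matrix.IsSymm.ext fun i j => ?_
      refine Fin.cases ?_ (fun k => ?_) i <;> refine Fin.cases ?_ (fun l => ?_) j <;>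
        simp [Z, fun i j => hQ.apply i j]
    have hTs : T.IsSymm := by
      refine Matrix.IsSymm.ext fun i j => ?_
      refine Fin.cases ?_ (fun k => ?_) i <;> refine Fin.cases ?_ (fun l => ?_) j <;> simp [T]
      rw [hQ.apply]
      ring
    have hZT : (Z + (2 : R) • T).det = Z.det := by
      rw [det_add_two_smul h4 Z T hZs hTs (hQ2 ▸ hQu.pow 2), Finset.mul_sum, Fin.sum_univ_succ]
      have h0 : T 0 0 = 0 := rfl
      rw [h0, Finset.sum_eq_zero fun i _ => by rw [← mul_assoc, hadj, zero_mul]]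
      ring
    set W := borderedMatrix (P.map fun x => x ^ 2) P.diag P.diag (((n + 1 : ℕ) : R) + 1)
    -- Pivoting `W` at the square of the pivot of `P` gives `Z + 2T`: the cross term of `(Q i j + u
    -- * r i * r j) ^ 2` is `2 * T`, and the corner drops by 1, which explains the value `n + 1`.
    let p : Fin (n + 2) := Fin.succ 0
    have hp : W p p = P 0 0 ^ 2 := rfl
    rw [det_eq_mul_det_schur W p (u ^ 2) (by rw [hp, ← mul_pow, hu, one_pow]), hp, hdet, mul_pow,
      hQ2, ← hZT]
    congr 2
    have hp0 : p.succAbove 0 = 0 := Fin.succ_succAbove_zero 0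
    have hps (i : Fin n) : p.succAbove i.succ = i.succ.succ := by
      simp only [p, Fin.succ_succAbove_succ, Fin.zero_succAbove]
    have hr (k : Fin n) : P k.succ 0 = r k := hs _ _
    have hW0 : W 0 0 = n + 1 + 1 := by simp [W]
    have hWp0 : W p 0 = P 0 0 := rfl
    have hW0p : W 0 p = P 0 0 := rfl
    have hWps (i : Fin n) : W p i.succ.succ = r i ^ 2 := rfl
    have hWsp (i : Fin n) : W i.succ.succ p = r i ^ 2 := by
      rw [← hr]
      rfl
    have hW0s (i : Fin n) : W 0 i.succ.succ = P i.succ i.succ := rfl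
    have hWs0 (i : Fin n) : W i.succ.succ 0 = P i.succ i.succ := rfl
    have hWss (i j : Fin n) : W i.succ.succ j.succ.succ = P i.succ j.succ ^ 2 := rfl
    have hQij (i j : Fin n) : Q i j = P i.succ j.succ - u * r i * r j := by
      rw [← hr]
      rfl
    have hT0s (i : Fin n) : T 0 i.succ = 0 := rfl
    have hTs0 (i : Fin n) : T i.succ 0 = 0 := rfl
    have hT0 : T 0 0 = 0 := rfl
    have hTss (i j : Fin n) : T i.succ j.succ = u * r i * r j * Q i j := rfl
    have hZ0s (i : Fin n) : Z 0 i.succ = Q i i := rfl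
    have hZs0 (i : Fin n) : Z i.succ 0 = Q i i := rfl
    have hZ0 : Z 0 0 = n + 1 := rfl
    have hZss (i j : Fin n) : Z i.succ j.succ = Q i j ^ 2 := rfl
    ext i j
    simp only [of_apply, Matrix.add_apply, Matrix.smul_apply, smul_eq_mul]
    refine Fin.cases ?_ (fun i => ?_) i <;> refine Fin.cases ?_ (fun j => ?_) j
    · rw [hp0, hZ0, hT0, hW0, hW0p, hWp0]
      linear_combination (u * P 0 0 + 1) * hu
    · rw [hp0, hps, hZ0s, hT0s, hW0s, hW0p, hWps, hQij]
      linear_combination (u * r j ^ 2) * hu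
    · rw [hp0, hps, hZs0, hTs0, hWs0, hWp0, hWsp, hQij]
      linear_combination (u * r i ^ 2) * hu
    · rw [hps, hps, hZss, hTss, hWss, hWps, hWsp, hQij]
      ring

end Bordered

/-! ### The polynomials `det (1 + xA)` and its bordered version -/

section AdjacencyPolynomials

variable {n : ℕ} (A : Matrix (Fin n) (Fin n) ℤ)

/-- The matrix `1 + X A`. -/
noncomputable def onePlusXSmul : Matrix (Fin n) (Fin n) ℤ[X] := 1 + (X : ℤ[X]) • A.map C

/-- The polynomial `det (1 + X A)`. -/
noncomputable def detOnePlus : ℤ[X] := (onePlusXSmul A).det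

/-- The determinant of `1 + X A` bordered by ones, with corner zero. -/
noncomputable def detOnePlusBordered : ℤ[X] := (borderedMatrix (onePlusXSmul A) 1 1 0).det

variable {A}

theorem onePlusXSmul_apply (i j : Fin n) :
    onePlusXSmul A i j = (1 : Matrix (Fin n) (Fin n) ℤ[X]) i j + X * C (A i j) := by
  simp [onePlusXSmul]

theorem det_borderedMatrix_onePlusXSmul (s : ℤ[X]) :
    (borderedMatrix (onePlusXSmul A) 1 1 s).det = s * detOnePlus A + detOnePlusBordered A :=
  det_borderedMatrix _ _ _ _

theorem charpolyRev_allOnes_sub (A : Matrix (Fin n) (Fin n) ℤ) :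
    (Matrix.of (fun _ _ => 1) - (2 : ℤ) • A).charpolyRev =
      (detOnePlus A).comp (C 2 * X) + X * (detOnePlusBordered A).comp (C 2 * X) := by
  let φ : ℤ[X] →+* ℤ[X] := compRingHom (C 2 * X)
  have h1 : (detOnePlus A).comp (C 2 * X) = (φ.mapMatrix (onePlusXSmul A)).det :=
    RingHom.map_det φ _
  have h2 : (detOnePlusBordered A).comp (C 2 * X) =
      (borderedMatrix (φ.mapMatrix (onePlusXSmul A)) 1 1 0).det := by
    rw [detOnePlusBordered, ← coe_compRingHom_apply, RingHom.map_det, map_borderedMatrix, map_zero]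
    congr 2 <;> funext i <;> simp
  have h3 := det_borderedMatrix_smul (φ.mapMatrix (onePlusXSmul A)) 1 1 1 X
  rw [h1, h2, ← one_mul (φ.mapMatrix (onePlusXSmul A)).det, ← h3, det_borderedMatrix_one, charpolyRev]
  congr 1
  ext1 i j
  simp only [Matrix.sub_apply, Matrix.smul_apply, Matrix.map_apply, of_apply, vecMulVec_apply,
    RingHom.mapMatrix_apply, onePlusXSmul_apply, Pi.smul_apply, Pi.one_apply, smul_eq_mul, φ]
  simp only [one_apply]
  split_ifs <;> simp <;> ring

/-- The squared determinant `det (1 + X A) ^ 2` modulo four. -/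
theorem detOnePlus_sq_coeff_modEq (hA : A.IsSymm) (hd : ∀ i, A i i = 0)
    (h2 : ∀ i j, A i j ^ 2 = A i j) (k : ℕ) :
    (detOnePlus A ^ 2).coeff k ≡
      (expand ℤ 2 ((n + 1) * detOnePlus A + detOnePlusBordered A)).coeff k [ZMOD 4] := by
  -- In power series everything congruent to 1 modulo `X` is a unit, so all pivots are invertible.
  let ψ : ℤ[X] →+* PowerSeries (ZMod 4) :=
    (coeToPowerSeries.ringHom).comp (mapRingHom (Int.castRingHom (ZMod 4)))
  have hψ (p : ℤ[X]) (k : ℕ) : PowerSeries.coeff k (ψ p) = (p.coeff k : ZMod 4) := by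
    simp [ψ]
  let θ : ℤ[X] →+* ℤ[X] := (expand ℤ 2 : ℤ[X] →+* ℤ[X])
  have hdiag : (ψ.mapMatrix (onePlusXSmul A)).diag = 1 := by
    funext i
    simp [onePlusXSmul_apply, hd]
  have hsq : (ψ.mapMatrix (onePlusXSmul A)).map (fun x => x ^ 2) =
      ψ.mapMatrix (θ.mapMatrix (onePlusXSmul A)) := by
    ext1 i j
    simp only [RingHom.mapMatrix_apply, Matrix.map_apply, ← map_pow]
    congr 1
    rw [onePlusXSmul_apply]
    rcases eq_or_ne i j with rfl | hij
    · simp [hd, θ]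
    · have h := h2 i j
      simp only [one_apply_ne hij, zero_add, θ, RingHom.coe_coe, map_mul, expand_X, expand_C,
        mul_pow, ← C_pow, h]
  have key := (det_sq_eq_det_borderedMatrix (R := PowerSeries (ZMod 4)) (by
      rw [← map_ofNat (PowerSeries.C (R := ZMod 4)) 4]
      exact (congrArg _ (by decide)).trans (map_zero _))
    (RingHom.ker (PowerSeries.constantCoeff (R := ZMod 4))) (fun x hx => by
      rw [PowerSeries.isUnit_iff_constantCoeff, map_add, (RingHom.mem_ker).mp hx]
      simp)
    (ψ.mapMatrix (onePlusXSmul A)) (by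
      refine Matrix.IsSymm.ext fun i j => ?_
      simp only [RingHom.mapMatrix_apply, Matrix.map_apply, onePlusXSmul_apply, hA.apply i j, one_apply,
        eq_comm])
    (fun i j => by
      rw [RingHom.mem_ker]
      rcases eq_or_ne i j with rfl | hij
      · simp [onePlusXSmul_apply, ψ]
      · simp [onePlusXSmul_apply, ψ, one_apply_ne hij])).2
  have hones : (1 : Fin n → PowerSeries (ZMod 4)) = ψ ∘ (θ ∘ (1 : Fin n → ℤ[X])) := by
    funext i
    simp
  rw [hdiag, hsq, hones, show ((n : PowerSeries (ZMod 4)) + 1) = ψ (θ (n + 1)) by simp,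
    ← map_borderedMatrix, ← map_borderedMatrix, ← RingHom.map_det, ← RingHom.map_det, ← RingHom.map_det, ← map_pow,
    det_borderedMatrix_onePlusXSmul] at key
  have := congrArg (PowerSeries.coeff k) key
  rw [hψ, hψ] at this
  exact (ZMod.intCast_eq_intCast_iff _ _ 4).mp this

end AdjacencyPolynomials

/-! ### Parity constraints on the coefficients -/

section Coefficients

theorem sum_antidiagonal_two_mul {M : Type*} [AddCommMonoid M] (f : ℕ → ℕ → M)
    (hf : ∀ i j, f i j = f j i) (k : ℕ) :
    ∑ p ∈ Finset.HasAntidiagonal.antidiagonal (2 * k), f p.1 p.2 =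
      2 • ∑ i ∈ Finset.range k, f i (2 * k - i) + f k k := by
  have h : ∑ x ∈ Finset.range k, f (k + 1 + x) (2 * k - (k + 1 + x)) =
      ∑ i ∈ Finset.range k, f i (2 * k - i) := by
    rw [← Finset.sum_range_reflect]
    refine Finset.sum_congr rfl fun i hi => ?_
    rw [Finset.mem_range] at hi
    rw [hf]
    congr 1 <;> omega
  rw [Finset.Nat.sum_antidiagonal_eq_sum_range_succ, show (2 * k).succ = (k + 1) + k by omega,
    Finset.sum_range_add, Finset.sum_range_succ, h, show 2 * k - k = k by omega]
  rw [two_nsmul]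
  abel

theorem sum_antidiagonal_two_mul_add_one {M : Type*} [AddCommMonoid M] (f : ℕ → ℕ → M)
    (hf : ∀ i j, f i j = f j i) (k : ℕ) :
    ∑ p ∈ Finset.HasAntidiagonal.antidiagonal (2 * k + 1), f p.1 p.2 =
      2 • ∑ i ∈ Finset.range (k + 1), f i (2 * k + 1 - i) := by
  have h : ∑ x ∈ Finset.range (k + 1), f (k + 1 + x) (2 * k + 1 - (k + 1 + x)) =
      ∑ i ∈ Finset.range (k + 1), f i (2 * k + 1 - i) := by
    rw [← Finset.sum_range_reflect]
    refine Finset.sum_congr rfl fun i hi => ?_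
    rw [Finset.mem_range] at hi
    rw [hf]
    congr 1 <;> omega
  rw [Finset.Nat.sum_antidiagonal_eq_sum_range_succ,
    show (2 * k + 1).succ = (k + 1) + (k + 1) by omega, Finset.sum_range_add, h, two_nsmul]

/-- The relations modulo four between the coefficients `c` of `det (1 + X A)`, for the adjacency
matrix `A` of a graph of order `n`, and the rescaled coefficients `b` of `det (1 - X (J - 2 A))`. -/
structure AdjacencyCoeffRelations (n : ℕ) (c b : ℕ → ℤ) : Prop where
  zero : c 0 = 1
  odd : ∀ k, ∑ p ∈ Finset.HasAntidiagonal.antidiagonal (2 * k + 1), c p.1 * c p.2 ≡ 0 [ZMOD 4]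
  even : ∀ k, b (k + 1) ≡ 2 * c (k + 1) - (n + 1) * c k +
    ∑ p ∈ Finset.HasAntidiagonal.antidiagonal (2 * k), c p.1 * c p.2 [ZMOD 4]

namespace AdjacencyCoeffRelations

variable {n : ℕ} {c b c' b' : ℕ → ℤ}

/-- In the folded sum every term except `c 0 * c (2k + 1)` has a factor of smaller odd index, hence
is even. -/
theorem two_dvd_odd (h : AdjacencyCoeffRelations n c b) (k : ℕ) : 2 ∣ c (2 * k + 1) := by
  induction k using Nat.strong_induction_on with
  | _ k ih =>
  have h1 := h.odd k
  rw [sum_antidiagonal_two_mul_add_one (fun i j => c i * c j) fun i j => mul_comm _ _,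
    Finset.sum_range_succ', h.zero] at h1
  have h2 : (2 : ℤ) ∣ ∑ i ∈ Finset.range k, c (i + 1) * c (2 * k + 1 - (i + 1)) := by
    refine Finset.dvd_sum fun i hi => ?_
    rw [Finset.mem_range] at hi
    obtain ⟨m, hm⟩ := Nat.even_or_odd' i
    rcases hm with rfl | rfl
    · exact Dvd.dvd.mul_right (ih m (by omega)) _
    · have := ih (k - 1 - m) (by omega)
      rw [show 2 * (k - 1 - m) + 1 = 2 * k + 1 - (2 * m + 1 + 1) by omega] at this
      exact Dvd.dvd.mul_left this _
  rw [Int.modEq_zero_iff_dvd] at h1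
  simp only [Nat.sub_zero, one_mul, nsmul_eq_mul, Nat.cast_ofNat] at h1
  omega

theorem modEq_two (h : AdjacencyCoeffRelations n c b) (hn : Odd n) (k : ℕ) :
    b (k + 1) ≡ c k [ZMOD 2] := by
  have h1 := (h.even k).of_dvd (show (2 : ℤ) ∣ 4 by norm_num)
  rw [sum_antidiagonal_two_mul (fun i j => c i * c j) fun i j => mul_comm _ _] at h1
  obtain ⟨m, rfl⟩ := hn
  have h2 : Even (c k * c k - c k) := by
    rw [show c k * c k - c k = (c k - 1) * (c k - 1 + 1) by ring]
    exact Int.even_mul_succ_self _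
  obtain ⟨r, hr⟩ := h2
  refine h1.trans (Int.modEq_iff_dvd.mpr ?_)
  refine ⟨-c (k + 1) + (m + 1) * c k - ∑ i ∈ Finset.range k, c i * c (2 * k - i) - r, ?_⟩
  simp only [nsmul_eq_mul]
  push_cast
  linear_combination -hr

/-- The relation for `b (k + 1)` contains `2 * c (2k)`; modulo 4 its other terms depend only on
parities of `c` at indices below `2k`. -/
theorem coeff_modEq_two (h : AdjacencyCoeffRelations n c b) (h' : AdjacencyCoeffRelations n c' b')
    (hn : Odd n) (h2 : c 2 ≡ c' 2 [ZMOD 2]) (K : ℕ)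
    (hb : ∀ j, 3 ≤ j → j ≤ K + 1 → b j ≡ b' j [ZMOD 4]) (m : ℕ) (hm : m ≤ 2 * K) :
    c m ≡ c' m [ZMOD 2] := by
  induction m using Nat.strong_induction_on with
  | _ m ih =>
  obtain ⟨k, hk⟩ := Nat.even_or_odd' m
  rcases hk with rfl | rfl
  swap
  · have h1 := h.two_dvd_odd k
    have h2 := h'.two_dvd_odd k
    exact ((Int.modEq_zero_iff_dvd.mpr h1).trans (Int.modEq_zero_iff_dvd.mpr h2).symm)
  rcases Nat.lt_or_ge k 2 with hk | hk
  -- For `k = 1` the two occurrences of `2 * c 2` cancel modulo 4, so `c 2` must be given.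
  · interval_cases k
    · simp [h.zero, h'.zero]
    · exact h2
  have double {x y : ℤ} (hxy : x ≡ y [ZMOD 2]) : 2 * x ≡ 2 * y [ZMOD 4] := hxy.mul_left' (c := 2)
  have hb1 := hb (k + 1) (by omega) (by omega)
  have e1 := h.even k
  have e2 := h'.even k
  rw [sum_antidiagonal_two_mul (fun i j => c i * c j) fun i j => mul_comm _ _] at e1
  rw [sum_antidiagonal_two_mul (fun i j => c' i * c' j) fun i j => mul_comm _ _] at e2
  obtain ⟨l, rfl⟩ : ∃ l, k = l + 1 := ⟨k - 1, by omega⟩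
  rw [Finset.sum_range_succ', h.zero] at e1
  rw [Finset.sum_range_succ', h'.zero] at e2
  have hs : ∑ i ∈ Finset.range l, c (i + 1) * c (2 * (l + 1) - (i + 1)) ≡
      ∑ i ∈ Finset.range l, c' (i + 1) * c' (2 * (l + 1) - (i + 1)) [ZMOD 2] := by
    refine Int.ModEq.sum fun i hi => ?_
    rw [Finset.mem_range] at hi
    exact (ih _ (by omega) (by omega)).mul (ih _ (by omega) (by omega))
  have hk1 := ih (l + 1) (by omega) (by omega)
  have hsq : c (l + 1) * c (l + 1) ≡ c' (l + 1) * c' (l + 1) [ZMOD 4] := by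
    obtain ⟨t, ht⟩ := hk1.dvd
    refine Int.modEq_iff_dvd.mpr ⟨t * (c (l + 1) + t), ?_⟩
    linear_combination (c' (l + 1) + c (l + 1) + 2 * t) * ht
  have hn1 : (n + 1) * c (l + 1) ≡ (n + 1) * c' (l + 1) [ZMOD 4] := by
    obtain ⟨m, rfl⟩ := hn
    have := double (hk1.mul_left (m + 1))
    push_cast
    convert this using 1 <;> ring
  have h1 := double (ih (l + 1 + 1) (by omega) (by omega))
  have hs2 := double hs
  simp only [Nat.sub_zero, one_mul, nsmul_eq_mul, Nat.cast_ofNat] at e1 e2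
  have e3 := (e1.symm.trans hb1).trans e2
  rw [Int.modEq_iff_dvd] at e3 hsq hn1 h1 hs2 ⊢
  omega

theorem modEq_pow (h : AdjacencyCoeffRelations n c b) (h' : AdjacencyCoeffRelations n c' b')
    (hn : Odd n) (e : ℕ) (h3 : b 3 ≡ b' 3 [ZMOD 2])
    (hb : ∀ i, i + 3 ≤ e → b (e - i) / 2 ≡ b' (e - i) / 2 [ZMOD 2 ^ i]) (j : ℕ) (hj : 3 ≤ j)
    (hje : j ≤ e) : b j ≡ b' j [ZMOD 2 ^ (e - j + 1)] := by
  induction j using Nat.strong_induction_on with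
  | _ j ih =>
  have hbit : b j ≡ b' j [ZMOD 2] := by
    obtain ⟨k, hk⟩ := Nat.even_or_odd' (j - 1)
    obtain ⟨i, rfl⟩ : ∃ i, j = i + 1 := ⟨j - 1, by omega⟩
    refine (h.modEq_two hn i).trans (Int.ModEq.trans ?_ (h'.modEq_two hn i).symm)
    have h2 : c 2 ≡ c' 2 [ZMOD 2] :=
      (h.modEq_two hn 2).symm.trans (h3.trans (h'.modEq_two hn 2))
    rw [Nat.add_sub_cancel] at hk
    rcases hk with rfl | rfl
    · refine h.coeff_modEq_two h' hn h2 k (fun l hl hlk => ?_) _ le_rfl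
      rcases Nat.lt_or_ge k 2 with hk2 | hk2
      · omega
      -- Here `l ≤ k + 1 < j ≤ e`, so the known modulus is at least 4.
      · refine (ih l (by omega) hl (by omega)).of_dvd ?_
        exact pow_dvd_pow (2 : ℤ) (show 2 ≤ e - l + 1 by omega)
    · exact (Int.modEq_zero_iff_dvd.mpr (h.two_dvd_odd k)).trans
        (Int.modEq_zero_iff_dvd.mpr (h'.two_dvd_odd k)).symm
  have h1 := (hb (e - j) (by omega)).mul_left' (c := 2)
  rw [show e - (e - j) = j by omega, ← pow_succ'] at h1
  rw [← Int.emod_add_mul_ediv (b j) 2, ← Int.emod_add_mul_ediv (b' j) 2, hbit]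
  exact h1.add_left _

end AdjacencyCoeffRelations

end Coefficients

/-! ### Seidel matrices and the count -/

section Seidel

variable {n : ℕ}

/-- Compare coefficients of `x²` in `det (1 - xM) det (1 + xM) = det (1 - x²M²)`. -/
theorem two_mul_coeff_two_charpolyRev {R : Type*} [CommRing R] (M : Matrix (Fin n) (Fin n) R) :
    2 * M.charpolyRev.coeff 2 = M.trace ^ 2 - (M ^ 2).trace := by
  have h1 : M.charpolyRev.comp (-X) = (1 + (X : R[X]) • M.map C).det := by
    rw [charpolyRev, ← coe_compRingHom_apply, RingHom.map_det]
    congr 1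
    ext1 i j
    simp only [RingHom.mapMatrix_apply, Matrix.map_apply, Matrix.sub_apply, Matrix.add_apply,
      Matrix.smul_apply, smul_eq_mul, one_apply, coe_compRingHom_apply, sub_comp, mul_comp, X_comp, C_comp]
    split_ifs <;> simp
  have h2 : M.charpolyRev * M.charpolyRev.comp (-X) = expand R 2 (M ^ 2).charpolyRev := by
    rw [h1, charpolyRev, ← det_mul, charpolyRev]
    have : expand R 2 (1 - (X : R[X]) • (M ^ 2).map C).det =
      ((expand R 2 : R[X] →+* R[X]).mapMatrix (1 - (X : R[X]) • (M ^ 2).map C)).det :=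
      RingHom.map_det (expand R 2 : R[X] →+* R[X]) _
    rw [this]
    congr 1
    have h3 : (M ^ 2).map (C : R →+* R[X]) = M.map C * M.map C := by
      rw [sq, Matrix.map_mul]
    have h4 : (expand R 2 : R[X] →+* R[X]).mapMatrix (1 - (X : R[X]) • (M ^ 2).map C) =
        1 - (X ^ 2 : R[X]) • (M ^ 2).map C := by
      rw [map_sub, map_one]
      congr 1
      ext1 i j
      simp
    rw [h4, h3, sq, ← smul_mul_smul_comm]
    generalize (X : R[X]) • M.map C = N
    noncomm_ring
  have h0 : M.charpolyRev.coeff 0 = 1 := by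
    rw [coeff_zero_eq_eval_zero, eval_charpolyRev]
  have h5 : (expand R 2 (M ^ 2).charpolyRev).coeff 2 = -(M ^ 2).trace := by
    rw [← coeff_charpolyRev_eq_neg_trace]
    exact coeff_expand_mul (by norm_num) _ 1
  rw [← h2, coeff_mul, Finset.Nat.sum_antidiagonal_eq_sum_range_succ_mk,
    show (-X : R[X]) = C (-1) * X by simp] at h5
  simp only [Finset.sum_range_succ, Finset.sum_range_zero, comp_C_mul_X_coeff, h0,
    show 2 - 1 = 1 from rfl, Nat.sub_zero, Nat.sub_self,
    coeff_charpolyRev_eq_neg_trace] at h5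
  linear_combination h5

/-- The adjacency matrix of the graph whose edges are the entries different from `1`. -/
def seidelAdjacency (S : Matrix (Fin n) (Fin n) ℤ) : Matrix (Fin n) (Fin n) ℤ :=
  Matrix.of fun i j => if i = j ∨ S i j = 1 then 0 else 1

/-- The coefficients of `det (1 - X (S + 1))`, with the `k`-th one divided by `2 ^ (k - 1)`. -/
noncomputable def seidelCoeff (S : Matrix (Fin n) (Fin n) ℤ) (k : ℕ) : ℤ :=
  (2 * detOnePlus (seidelAdjacency S) + X * detOnePlusBordered (seidelAdjacency S)).coeff k

variable {S S' : Matrix (Fin n) (Fin n) ℤ}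

theorem IsSeidelMatrix.add_one_eq (hS : IsSeidelMatrix S) :
    S + 1 = Matrix.of (fun _ _ => 1) - (2 : ℤ) • seidelAdjacency S := by
  ext i j
  rcases eq_or_ne i j with rfl | hij
  · simp [seidelAdjacency, hS.diag_eq_zero]
  · rcases hS.off_diag i j hij with h | h <;> simp [seidelAdjacency, one_apply_ne hij, h, hij]

theorem IsSeidelMatrix.coeff_charpolyRev (hS : IsSeidelMatrix S) (k : ℕ) :
    (S + 1).charpolyRev.coeff (k + 1) = 2 ^ k * seidelCoeff S (k + 1) := by
  rw [hS.add_one_eq, charpolyRev_allOnes_sub, coeff_add, coeff_X_mul, comp_C_mul_X_coeff,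
    comp_C_mul_X_coeff, seidelCoeff, coeff_add, coeff_X_mul, ← C_ofNat, coeff_C_mul, pow_succ]
  ring

theorem IsSeidelMatrix.adjacencyCoeffRelations (hS : IsSeidelMatrix S) :
    AdjacencyCoeffRelations n (detOnePlus (seidelAdjacency S)).coeff (seidelCoeff S) := by
  have key := detOnePlus_sq_coeff_modEq (A := seidelAdjacency S)
    (by
      refine Matrix.IsSymm.ext fun i j => ?_
      simp only [seidelAdjacency, of_apply, hS.isSymm.apply i j, eq_comm (a := i)])
    (fun i => by simp [seidelAdjacency])
    (fun i j => by
      simp only [seidelAdjacency, of_apply]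
      split_ifs <;> norm_num)
  refine ⟨?_, fun k => ?_, fun k => ?_⟩
  · rw [detOnePlus, onePlusXSmul, coeff_zero_eq_eval_zero, eval_det_add_X_smul]
    simp
  · have := key (2 * k + 1)
    rwa [sq, coeff_mul, coeff_expand (by norm_num), if_neg (by omega)] at this
  · have := key (2 * k)
    rw [sq, coeff_mul, coeff_expand_mul' (by norm_num), coeff_add] at this
    rw [seidelCoeff, coeff_add, coeff_X_mul, ← C_ofNat, coeff_C_mul]
    have h : (((n : ℤ[X]) + 1) * detOnePlus (seidelAdjacency S)).coeff k =
        (n + 1) * (detOnePlus (seidelAdjacency S)).coeff k := by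
      rw [show (n : ℤ[X]) + 1 = C ((n : ℤ) + 1) by simp, coeff_C_mul]
    rw [h] at this
    rw [Int.modEq_iff_dvd] at *
    exact (dvd_neg.mpr this).trans (dvd_of_eq (by ring))

theorem IsSeidelMatrix.coeff_two_charpolyRev (hS : IsSeidelMatrix S) :
    (S + 1).charpolyRev.coeff 2 = 0 := by
  have h := two_mul_coeff_two_charpolyRev (S + 1)
  have h1 : (S + 1).trace = n := by simp [trace, hS.diag_eq_zero]
  have h2 : ((S + 1) ^ 2).trace = (n : ℤ) ^ 2 := by
    have (i j : Fin n) : (S + 1) i j * (S + 1) j i = 1 := by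
      rcases eq_or_ne i j with rfl | hij
      · simp [hS.diag_eq_zero]
      · rw [Matrix.add_apply, Matrix.add_apply, one_apply_ne hij, one_apply_ne hij.symm,
          hS.isSymm.apply i j]
        rcases hS.off_diag i j hij with h | h <;> simp [h]
    simp only [sq, trace, diag, mul_apply, this]
    simp
  rw [h1, h2] at h
  omega

theorem IsSeidelMatrix.charpolyRev_modEq (hS : IsSeidelMatrix S) (hS' : IsSeidelMatrix S')
    (hn : Odd n) (e : ℕ) (h3 : seidelCoeff S 3 ≡ seidelCoeff S' 3 [ZMOD 2])
    (hb : ∀ i, i + 3 ≤ e →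
      seidelCoeff S (e - i) / 2 ≡ seidelCoeff S' (e - i) / 2 [ZMOD 2 ^ i]) (k : ℕ) :
    (S + 1).charpolyRev.coeff k ≡ (S' + 1).charpolyRev.coeff k [ZMOD 2 ^ e] := by
  have htr {T : Matrix (Fin n) (Fin n) ℤ} (hT : IsSeidelMatrix T) : (T + 1).trace = n := by
    simp [trace, hT.diag_eq_zero]
  match k with
  | 0 => rw [coeff_zero_eq_eval_zero, eval_charpolyRev, coeff_zero_eq_eval_zero, eval_charpolyRev]
  | 1 => 
    rw [coeff_charpolyRev_eq_neg_trace, coeff_charpolyRev_eq_neg_trace, htr hS, htr hS']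
  | 2 => rw [hS.coeff_two_charpolyRev, hS'.coeff_two_charpolyRev]
  | k + 3 =>
    rw [hS.coeff_charpolyRev (k + 2), hS'.coeff_charpolyRev (k + 2)]
    rcases Nat.lt_or_ge e (k + 3) with hk | hk
    · have h : (2 : ℤ) ^ e ∣ 2 ^ (k + 2) := pow_dvd_pow _ (by omega)
      exact (Int.modEq_zero_iff_dvd.mpr (h.mul_right _)).trans
        (Int.modEq_zero_iff_dvd.mpr (h.mul_right _)).symm
    · have h := (hS.adjacencyCoeffRelations.modEq_pow hS'.adjacencyCoeffRelations hn e h3 hb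
        (k + 3) (by omega) hk).mul_left' (c := 2 ^ (k + 2))
      rwa [← pow_add, show k + 2 + (e - (k + 3) + 1) = e by omega] at h

/-- Reversing coefficients and substituting `x + 1` both preserve congruence. -/
theorem mk_charpoly_eq_of_charpolyRev_modEq {M M' : Matrix (Fin n) (Fin n) ℤ} (e : ℕ)
    (h : ∀ k, (M + 1).charpolyRev.coeff k ≡ (M' + 1).charpolyRev.coeff k [ZMOD 2 ^ e]) :
    Ideal.Quotient.mk (twoPowIdeal e) M.charpoly =
      Ideal.Quotient.mk (twoPowIdeal e) M'.charpoly := by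
  have hcomp (T : Matrix (Fin n) (Fin n) ℤ) : T.charpoly = (T + 1).charpoly.comp (X + C 1) := by
    rw [← charpoly_sub_scalar]
    simp
  have hdvd : C ((2 : ℤ) ^ e) ∣ (M + 1).charpoly - (M' + 1).charpoly := by
    rw [C_dvd_iff_dvd_coeff]
    intro k
    rcases Nat.lt_or_ge n k with hk | hk
    · have hz (T : Matrix (Fin n) (Fin n) ℤ) : T.charpoly.coeff k = 0 :=
        coeff_eq_zero_of_natDegree_lt (by rw [charpoly_natDegree_eq_dim, Fintype.card_fin]; exact hk)
      rw [coeff_sub, hz, hz, sub_zero]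
      exact dvd_zero _
    · have hr (T : Matrix (Fin n) (Fin n) ℤ) : T.charpoly.coeff k = T.charpolyRev.coeff (n - k) := by
        rw [← reverse_charpoly, coeff_reverse, charpoly_natDegree_eq_dim, Fintype.card_fin,
          revAt_le (Nat.sub_le _ _), Nat.sub_sub_self hk]
      rw [coeff_sub, hr, hr]
      exact (h (n - k)).symm.dvd
  rw [Ideal.Quotient.eq, twoPowIdeal, Ideal.mem_span_singleton, hcomp, hcomp M', ← sub_comp]
  obtain ⟨q, hq⟩ := hdvd
  rw [hq, mul_comp, C_comp]
  exact dvd_mul_right _ _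

/-- Residues of the coefficients that determine the characteristic polynomial modulo `2 ^ e`. -/
noncomputable def seidelCode (e : ℕ) (S : Matrix (Fin n) (Fin n) ℤ) :
    ZMod 2 × ((i : Fin (e - 2)) → ZMod (2 ^ (i : ℕ))) :=
  (seidelCoeff S 3, fun i => ((seidelCoeff S (e - i) / 2 : ℤ) : ZMod (2 ^ (i : ℕ))))

theorem IsSeidelMatrix.mk_charpoly_eq_of_seidelCode_eq (hS : IsSeidelMatrix S)
    (hS' : IsSeidelMatrix S') (hn : Odd n) (e : ℕ) (h : seidelCode e S = seidelCode e S') :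
    Ideal.Quotient.mk (twoPowIdeal e) S.charpoly =
      Ideal.Quotient.mk (twoPowIdeal e) S'.charpoly := by
  rw [seidelCode, seidelCode, Prod.mk.injEq] at h
  refine mk_charpoly_eq_of_charpolyRev_modEq e
    (hS.charpolyRev_modEq hS' hn e ((ZMod.intCast_eq_intCast_iff _ _ 2).mp h.1) fun i hi => ?_)
  have := congrFun h.2 ⟨i, by omega⟩
  simpa using (ZMod.intCast_eq_intCast_iff _ _ (2 ^ i)).mp this

theorem card_seidelCode (e : ℕ) :
    Fintype.card (ZMod 2 × ((i : Fin (e - 2)) → ZMod (2 ^ (i : ℕ)))) =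
      2 ^ (Nat.choose (e - 2) 2 + 1) := by
  rw [Fintype.card_prod, Fintype.card_pi]
  simp only [ZMod.card]
  -- The exponents `0, …, e - 3` sum to the binomial coefficient; the extra 1 is the parity of `b
  -- 3`.
  rw [Finset.prod_pow_eq_pow_sum, Fin.sum_univ_eq_sum_range (fun i => i), Finset.sum_range_id,
    Nat.choose_two_right, pow_succ']

end Seidel

/-- `Set.encard` is the extended cardinality, so the bound includes finiteness. For `e = 1` the
truncated `e - 2` makes the binomial coefficient `0`, its smallest reading. -/
theorem mainTheorem3 (n e : ℕ) (hn : Odd n) (he : 1 ≤ e) :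
    (seidelCharpolyClasses n e).encard ≤ 2 ^ (Nat.choose (e - 2) 2 + 1) := by
  have hex (q : Polynomial ℤ ⧸ twoPowIdeal e) : ∃ S : Matrix (Fin n) (Fin n) ℤ,
      q ∈ seidelCharpolyClasses n e →
        IsSeidelMatrix S ∧ Ideal.Quotient.mk (twoPowIdeal e) S.charpoly = q := by
    by_cases hq : q ∈ seidelCharpolyClasses n e
    · obtain ⟨S, hS, rfl⟩ := hq
      exact ⟨S, fun _ => ⟨hS, rfl⟩⟩
    · exact ⟨0, fun h => absurd h hq⟩
  choose f hf using hex
  have hinj : Set.InjOn (fun q => seidelCode e (f q)) (seidelCharpolyClasses n e) := by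
    intro q hq q' hq' h
    rw [← (hf q hq).2, ← (hf q' hq').2]
    exact (hf q hq).1.mk_charpoly_eq_of_seidelCode_eq (hf q' hq').1 hn e h
  refine (Set.encard_le_encard_of_injOn (Set.mapsTo_univ _ _) hinj).trans ?_
  rw [Set.encard_univ, ENat.card_eq_coe_fintype_card, card_seidelCode]
  push_cast
  exact le_rfl
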